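/- **Setting.** Fix integers $L\ge 0$, $K\ge 1$, $W_0\ge 1$, a per-slot transmission probability $\tau\in[0,1]$, and durations $\sigma,t_s,t_c>0$ (idle minislot, successful transmission, collided transmission). Put $p_c=1-(1-\tau)^L$, $W_j=2^jW_0$, $P_k=(1-p_c)p_c^k$ for $0\le k\le K-2$ and $P_{K-1}=p_c^{K-1}$. Consider an on-off semi-Markov process with transition matrix $\mathbf P=\begin{pmatrix}0&1\\1&0\end{pmatrix}$ (states ordered off, on) and any initial distribution. Each "on" period has the constant length $t_s$. The "off" periods are i.i.d. copies of $$t_{\rm off}=\kappa t_c+\sum_{l=1}^{B}X_l,\qquad B=\sum_{j=0}^{\kappa}\eta_j,$$ where all the variables $\kappa,\eta_0,\dots,\eta_{K-1},X_1,X_2,\dots$ are independent, $\Pr\{\kappa=k\}=P_k$ for $0\le k\le K-1$, $\eta_j$ is uniform on $\{0,\dots,W_j-1\}$, and each $X_l$ equals $\sigma$, $t_s$, $t_c$ with probabilities $(1-\tau)^L$, $L\tau(1-\tau)^{L-1}$, $p_c-L\tau(1-\tau)^{L-1}$. For a user with bandwidth $\beta\ge0$ and average SNR $\bar\gamma\ge0$,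 bits are served at the constant rate $r=\beta\log_2(1+\bar\gamma)$ in the "on" state and at rate zero in the "off" state; $S(t)$ is the number of bits served during $[0,t)$. The effective capacity at QoS exponent $\theta>0$ is $$C(\beta,\theta)=\lim_{t\to\infty}-\frac1{\theta t}\log\mathbb E\,e^{-\theta S(t)}.$$ **Claim.** (1) For every $z>0$ the probability generating functions of $X$, $\eta_j$ and $t_{\rm off}$ are finite and are $$\hat X(z)=(1-\tau)^Lz^{\sigma}+L\tau(1-\tau)^{L-1}z^{t_s}+\bigl(p_c-L\tau(1-\tau)^{L-1}\bigr)z^{t_c},\qquad \hat\eta_j(z)=\frac1{W_j}\,\frac{1-z^{W_j}}{1-z}\quad(\hat\eta_j(1)=1),$$ $$\hat t_{\rm off}(z)=\mathbb E\,z^{t_{\rm off}}=\sum_{k=0}^{K-1}P_k\,z^{kt_c}\prod_{i=0}^{k}\hat\eta_i(\hat X(z)).$$ (2) The function $F(x)=\log\hat t_{\rm off}(e^x)+x\,t_s$ is strictly increasing on $\mathbb R$ and is a bijection of $\mathbb R$ onto $\mathbb R$. (3) For all $\beta\ge0$, $\bar\gamma\ge0$, $\theta>0$, the limit defining the effective capacity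 exists and $$C(\beta,\theta)=\frac1\theta\,F^{-1}\bigl(\beta\,\theta\,\log_2(1+\bar\gamma)\,t_s\bigr).$$ (4) Let $\mathbf H(s,u)=\operatorname{diag}\bigl(\hat t_{\rm off}(e^{-u}),\,e^{(\beta\log_2(1+\bar\gamma)s-u)t_s}\bigr)\,\mathbf P$ and let $\phi(s,u)$ be its spectral radius. For all $\beta\ge0$, $\bar\gamma\ge0$, $\theta>0$, the value $C(\beta,\theta)$ in (3) is the unique real number $C$ with $\phi(-\theta,-\theta C)=1$. -/

import Mathlib

open MeasureTheory ProbabilityTheory Filter Topology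

noncomputable section

/-- Parameters of the DCF channel: `L` contending nodes, at most `K` transmission attempts per
packet, initial contention window `W₀`, per-slot transmission probability `τ` of a node, and the
durations `σ` (idle minislot), `ts` (successful transmission), `tc` (collided transmission). -/
structure DCFParams where
  L : ℕ
  K : ℕ
  W₀ : ℕ
  τ : ℝ
  σ : ℝ
  ts : ℝ
  tc : ℝ
  K_pos : 0 < K
  W₀_pos : 0 < W₀
  τ_nonneg : 0 ≤ τ
  τ_le_one : τ ≤ 1
  σ_pos : 0 < σ
  ts_pos : 0 < ts
  tc_pos : 0 < tc

namespace DCFParams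

/-- Collision probability per slot: `1 - p_c = (1 - τ) ^ L`. -/
def pc (p : DCFParams) : ℝ := 1 - (1 - p.τ) ^ p.L

/-- Contention window of the `j`-th attempt; it doubles after every failure. -/
def W (p : DCFParams) (j : ℕ) : ℕ := 2 ^ j * p.W₀

/-- `P_k`, the probability that a packet experiences `k` collisions, `k = 0, …, K - 1`. -/
def collisionProb (p : DCFParams) (k : ℕ) : ℝ :=
  if k + 1 = p.K then p.pc ^ (p.K - 1) else (1 - p.pc) * p.pc ^ k

/-- Probability that a slot is idle. -/
def probIdle (p : DCFParams) : ℝ := (1 - p.τ) ^ p.L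

/-- Probability that a slot holds a collision-free transmission of another node. (For `L = 0` the
factor `L` makes this zero.) -/
def probSuccess (p : DCFParams) : ℝ := p.L * p.τ * (1 - p.τ) ^ (p.L - 1)

/-- Probability that a slot holds collided transmissions of other nodes. -/
def probCollision (p : DCFParams) : ℝ := p.pc - p.probSuccess

/-- The law of the duration `X` of a slot. -/
def slotLaw (p : DCFParams) : Measure ℝ :=
  ENNReal.ofReal p.probIdle • Measure.dirac p.σ
    + ENNReal.ofReal p.probSuccess • Measure.dirac p.ts
    + ENNReal.ofReal p.probCollision • Measure.dirac p.tc

/-- The explicit expression `X̂(z)`. -/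
def slotExpr (p : DCFParams) (z : ℝ) : ℝ :=
  p.probIdle * z ^ p.σ + p.probSuccess * z ^ p.ts + p.probCollision * z ^ p.tc

/-- The explicit expression `η̂_j(z) = (1 / W_j) (1 - z ^ W_j) / (1 - z)`, with its continuous
extension `1` at `z = 1`. -/
def backoffExpr (p : DCFParams) (j : ℕ) (z : ℝ) : ℝ :=
  if z = 1 then 1 else 1 / (p.W j : ℝ) * ((1 - z ^ p.W j) / (1 - z))

/-- The explicit expression `∑_{k < K} P_k z^{k t_c} ∏_{i ≤ k} η̂_i(X̂(z))`. -/
def offExpr (p : DCFParams) (z : ℝ) : ℝ :=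
  ∑ k ∈ Finset.range p.K,
    p.collisionProb k * z ^ ((k : ℝ) * p.tc) *
      ∏ i ∈ Finset.range (k + 1), p.backoffExpr i (p.slotExpr z)

end DCFParams

/-- Index set of the elementary random variables: for the `i`-th off-period the number of
collisions, the backoff timers of the attempts `j < K`, and the durations of the slots. -/
inductive DCFVar (K : ℕ) : Type
  | collisions (i : ℕ)
  | backoff (i : ℕ) (j : Fin K)
  | slot (i l : ℕ)

/-- The elementary random variables as one real-valued family. -/
def dcfFamily {Ω : Type*} {K : ℕ} (κ : ℕ → Ω → Fin K) (η : ℕ → Fin K → Ω → ℕ)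
    (X : ℕ → ℕ → Ω → ℝ) : DCFVar K → Ω → ℝ
  | .collisions i => fun ω => ((κ i ω : ℕ) : ℝ)
  | .backoff i j => fun ω => (η i j ω : ℝ)
  | .slot i l => X i l

/-- Transition matrix between the states `0` ("off") and `1` ("on"). -/
def onOffTransition : Matrix (Fin 2) (Fin 2) ℝ := !![0, 1; 1, 0]

/-- The random variables behind the on-off semi-Markov model of the retransmissions of one user.
The state sequence `J` has the one-step transition matrix `onOffTransition` and an arbitrary initial
distribution. -/
structure DCFModel {Ω : Type*} [MeasurableSpace Ω] (p : DCFParams) (μ : Measure Ω) where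
  /-- `J m` is the state after `m` transitions, `0` for "off" and `1` for "on". -/
  J : ℕ → Ω → Fin 2
  /-- `κ i` is the number of collisions in the `i`-th off-period. -/
  κ : ℕ → Ω → Fin p.K
  /-- `η i j` is the number of slots backed off at the `j`-th attempt in the `i`-th off-period. -/
  η : ℕ → Fin p.K → Ω → ℕ
  /-- `X i l` is the duration of the `l`-th backoff slot in the `i`-th off-period. -/
  X : ℕ → ℕ → Ω → ℝ
  measurable_J : ∀ m, Measurable (J m)
  measurable_κ : ∀ i, Measurable (κ i)
  measurable_η : ∀ i j, Measurable (η i j)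
  measurable_X : ∀ i l, Measurable (X i l)
  transition_J : ∀ m a b,
    μ.real {ω | J m ω = a ∧ J (m + 1) ω = b} = μ.real {ω | J m ω = a} * onOffTransition a b
  law_κ : ∀ i k, μ.real {ω | κ i ω = k} = p.collisionProb k
  law_η : ∀ i (j : Fin p.K) (w : ℕ), w < p.W j → μ.real {ω | η i j ω = w} = 1 / (p.W j : ℝ)
  law_X : ∀ i l, μ.map (X i l) = p.slotLaw
  indep : iIndepFun (dcfFamily κ η X) μ

/-- Probability generating function `z ↦ 𝔼[z ^ Y]` of a real random variable. -/
def realPGF {Ω : Type*} [MeasurableSpace Ω] (μ : Measure Ω) (Y : Ω → ℝ) (z : ℝ) : ℝ :=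
  ∫ ω, z ^ Y ω ∂μ

namespace DCFModel

variable {Ω : Type*} [MeasurableSpace Ω] {p : DCFParams} {μ : Measure Ω}

/-- Total number `B = ∑_{j ≤ κ} η_j` of slots backed off in the `i`-th off-period. -/
def backoffSlots (M : DCFModel p μ) (i : ℕ) (ω : Ω) : ℕ :=
  ∑ j ∈ Finset.Iic (M.κ i ω), M.η i j ω

/-- Duration `t_off = κ t_c + ∑_{l < B} X_l` of the `i`-th off-period. -/
def offTime (M : DCFModel p μ) (i : ℕ) (ω : Ω) : ℝ :=
  ((M.κ i ω : ℕ) : ℝ) * p.tc + ∑ l ∈ Finset.range (M.backoffSlots i ω), M.X i l ω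

/-- Number of visits to "off" before the `m`-th transition. -/
def offVisits (M : DCFModel p μ) (m : ℕ) (ω : Ω) : ℕ :=
  ((Finset.range m).filter fun l => M.J l ω = 0).card

/-- Sojourn time in the state `J m`. -/
def sojourn (M : DCFModel p μ) (m : ℕ) (ω : Ω) : ℝ :=
  if M.J m ω = 0 then M.offTime (M.offVisits m ω) ω else p.ts

/-- Time of the `m`-th transition. -/
def jumpTime (M : DCFModel p μ) (m : ℕ) (ω : Ω) : ℝ :=
  ∑ l ∈ Finset.range m, M.sojourn l ω

/-- The set of times at which the semi-Markov process is "on". -/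
def onTimes (M : DCFModel p μ) (ω : Ω) : Set ℝ :=
  {s | ∃ m, M.J m ω = 1 ∧ M.jumpTime m ω ≤ s ∧ s < M.jumpTime (m + 1) ω}

/-- Number `S(t)` of bits served during `[0, t)` when the service rate is `r` in state "on" and zero
in state "off". -/
def service (M : DCFModel p μ) (r t : ℝ) (ω : Ω) : ℝ :=
  ∫ s in Set.Ico 0 t, (M.onTimes ω).indicator (fun _ => r) s

/-- The PGF of the off-period. -/
def offPGF (M : DCFModel p μ) (z : ℝ) : ℝ := realPGF μ (M.offTime 0) z

/-- The diagonal matrix `Γ(s, u)` of the moment generating functions, for "on"-rate `r`. -/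
def Gam (M : DCFModel p μ) (r s u : ℝ) : Matrix (Fin 2) (Fin 2) ℝ :=
  Matrix.diagonal ![M.offPGF (Real.exp (-u)), Real.exp ((r * s - u) * p.ts)]

/-- `H(s, u) = Γ(s, u) P`. -/
def H (M : DCFModel p μ) (r s u : ℝ) : Matrix (Fin 2) (Fin 2) ℝ :=
  M.Gam r s u * onOffTransition

/-- `φ(s, u)`, the spectral radius of `H(s, u)`. -/
def phi (M : DCFModel p μ) (r s u : ℝ) : ENNReal :=
  spectralRadius ℂ ((M.H r s u).map (fun a => (a : ℂ)))

/-- `F(x) = log t̂_off(e ^ x) + x t_s`. -/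
def F (M : DCFModel p μ) (x : ℝ) : ℝ :=
  Real.log (M.offPGF (Real.exp x)) + x * p.ts

end DCFModel

/-- `C` is the effective capacity at QoS exponent `θ` of the service process `S`: the limit of
`-(1 / (θ t)) log 𝔼[e ^ (-θ S(t))]` exists and equals `C`. -/
def IsEffectiveCapacity {Ω : Type*} [MeasurableSpace Ω] (μ : Measure Ω) (S : ℝ → Ω → ℝ)
    (θ C : ℝ) : Prop :=
  (∀ t, 0 ≤ t → Integrable (fun ω => Real.exp (-θ * S t ω)) μ) ∧
    Tendsto (fun t : ℝ => -(1 / (θ * t)) * Real.log (∫ ω, Real.exp (-θ * S t ω) ∂μ)) atTop (𝓝 C)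

end

/-! ### Measurability of randomly indexed sums. -/

section RandomSums

variable {Ω : Type*} [MeasurableSpace Ω]

/-! Almost surely an off-period lies in `[0, p.offMax]`, since the collision count, the backoff
timers and the slot durations are bounded; hence all exponential moments exist. The formula for its
PGF comes from conditioning: given the number of slots, each independent slot contributes a factor
`p.slotExpr z`; averaging over the timers gives the factors `p.backoffExpr`, and summing over the
collision count gives `p.offExpr` (`realPGF_offTime`).

`F` is the log-MGF of a cycle, that is, of one off-period and one on-period. As off-periods are
nonnegative, `F` grows at least with slope `p.ts` (`F_add_le`); with continuity this makes it a
bijection of the line.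

For the effective capacity, let `T n` be the end of the `n`-th cycle. Then `exp (x * T n - n * F x)`
is a martingale of mean one. If `T N ≤ t < T (N + 1)`, the bits served lie between those of `N` and
`N + 1` on-periods, whichever state comes first. With `F x = θ * r * p.ts`, the variable `exp (-θ *
S t)` is therefore comparable, up to constant factors, to `exp (-x * t)` times the martingale
stopped at `N + 1`, because `T (N + 1) - t` is bounded. Taking expectations
(`integral_stoppedMart`), logarithms and the limit gives `x / θ`.

The matrix in the last claim is antidiagonal, so its spectral radius is the square root of the
product of its two entries. That product is `exp (F (θ * C) - θ * r * p.ts)`, which equals one only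
for this `C`. -/

lemma measurable_comp_countable {ι β : Type*} [Countable ι] [MeasurableSpace ι]
    [MeasurableSingletonClass ι] [MeasurableSpace β] {N : Ω → ι} {f : ι → Ω → β}
    (hN : Measurable N) (hf : ∀ n, Measurable (f n)) : Measurable fun ω => f (N ω) ω :=
  (measurable_from_prod_countable_right (f := fun q : ι × Ω => f q.1 q.2) hf).comp
    (hN.prodMk measurable_id)

lemma measurable_backoffSum {K : ℕ} {κ : Ω → Fin K} {η : Fin K → Ω → ℕ}
    (hκ : Measurable κ) (hη : ∀ j, Measurable (η j)) :
    Measurable fun ω => ∑ j ∈ Finset.Iic (κ ω), η j ω :=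
  measurable_comp_countable (f := fun k ω => ∑ j ∈ Finset.Iic k, η j ω) hκ
    fun _ => Finset.measurable_sum _ fun j _ => hη j

/-- Stated for an arbitrary σ-algebra on `Ω`, so that it serves both the ambient one and the
σ-algebras generated by part of the elementary variables. -/
lemma measurable_compoundTime {K : ℕ} {κ : Ω → Fin K} {η : Fin K → Ω → ℕ} {X : ℕ → Ω → ℝ}
    (c : ℝ) (hκ : Measurable κ) (hη : ∀ j, Measurable (η j)) (hX : ∀ l, Measurable (X l)) :
    Measurable fun ω => ((κ ω : ℕ) : ℝ) * c +
      ∑ l ∈ Finset.range (∑ j ∈ Finset.Iic (κ ω), η j ω), X l ω := by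
  refine Measurable.add ?_ ?_
  · exact (measurable_of_countable (fun k : Fin K => ((k : ℕ) : ℝ) * c)).comp hκ
  · exact measurable_comp_countable (f := fun n ω => ∑ l ∈ Finset.range n, X l ω)
      (measurable_backoffSum hκ hη) fun n => Finset.measurable_sum _ fun l _ => hX l

end RandomSums

/-! ### The law of a slot and bounds on durations. -/

namespace DCFParams

variable (p : DCFParams)

lemma probIdle_nonneg : 0 ≤ p.probIdle := pow_nonneg (sub_nonneg.2 p.τ_le_one) _

lemma probSuccess_nonneg : 0 ≤ p.probSuccess :=
  mul_nonneg (mul_nonneg (Nat.cast_nonneg _) p.τ_nonneg)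
    (pow_nonneg (sub_nonneg.2 p.τ_le_one) _)

/-- The left side is the probability that at most one of `n` independent nodes transmits, each being
silent with probability `q`. -/
lemma pow_add_mul_pow_le_one {q : ℝ} (h0 : 0 ≤ q) (h1 : q ≤ 1) (n : ℕ) :
    q ^ n + n * (1 - q) * q ^ (n - 1) ≤ 1 := by
  rcases n with _ | n
  · simp
  induction n with
  | zero => simp
  | succ n ih =>
    simp only [Nat.add_sub_cancel] at ih ⊢
    have hq : 0 ≤ q ^ n := pow_nonneg h0 n
    have hq1 : q ^ (n + 1) ≤ 1 := pow_le_one₀ h0 h1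
    push_cast at ih ⊢
    -- Condition on one further node: it is silent and at most one other transmits, or it transmits
    -- and all others are silent.
    have e : q ^ (n + 1 + 1) + (n + 1 + 1) * (1 - q) * q ^ (n + 1)
        = q * (q ^ (n + 1) + (n + 1) * (1 - q) * q ^ n) + (1 - q) * q ^ (n + 1) := by ring
    rw [e]
    nlinarith [mul_le_mul_of_nonneg_left ih h0,
      mul_le_mul_of_nonneg_left hq1 (sub_nonneg.2 h1)]

lemma probCollision_nonneg : 0 ≤ p.probCollision := by
  have h := pow_add_mul_pow_le_one (q := 1 - p.τ) (sub_nonneg.2 p.τ_le_one)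
    (by linarith [p.τ_nonneg]) p.L
  unfold probCollision probSuccess pc
  rw [sub_sub_cancel] at h
  linarith

lemma W_pos (j : ℕ) : 0 < p.W j := Nat.mul_pos (by positivity) p.W₀_pos

/-- The longest possible duration of a slot. -/
noncomputable def slotMax : ℝ := max p.σ (max p.ts p.tc)

lemma slotMax_nonneg : 0 ≤ p.slotMax := p.σ_pos.le.trans (le_max_left _ _)

/-- The largest number of slots that can be backed off in an off-period. -/
def backoffMax : ℕ := ∑ j : Fin p.K, p.W j

/-- An upper bound of the duration of an off-period. -/
noncomputable def offMax : ℝ := p.K * p.tc + p.backoffMax * p.slotMax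

lemma integral_slotLaw (f : ℝ → ℝ) : ∫ x, f x ∂p.slotLaw =
    p.probIdle * f p.σ + p.probSuccess * f p.ts + p.probCollision * f p.tc := by
  have h (x : ℝ) (c : ℝ) : Integrable f (ENNReal.ofReal c • Measure.dirac x) :=
    (integrable_dirac (by finiteness)).smul_measure ENNReal.ofReal_ne_top
  unfold slotLaw
  rw [integral_add_measure ((h _ _).add_measure (h _ _)) (h _ _),
    integral_add_measure (h _ _) (h _ _)]
  simp [ENNReal.toReal_ofReal, p.probIdle_nonneg, p.probSuccess_nonneg, p.probCollision_nonneg]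

end DCFParams

/-! ### Independence of groups of elementary variables, and almost sure bounds. -/

namespace DCFModel

variable {Ω : Type*} [MeasurableSpace Ω] {p : DCFParams} {μ : Measure Ω} (M : DCFModel p μ)

lemma measurable_dcfFamily (v : DCFVar p.K) : Measurable (dcfFamily M.κ M.η M.X v) := by
  cases v with
  | collisions i =>
    exact (measurable_of_countable (fun k : Fin p.K => ((k : ℕ) : ℝ))).comp (M.measurable_κ i)
  | backoff i j =>
    exact (measurable_of_countable (fun k : ℕ => (k : ℝ))).comp (M.measurable_η i j)
  | slot i l => exact M.measurable_X i l

/-- The σ-algebra generated by the elementary variables with index in `S`. -/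
@[reducible]
def sigma (S : Set (DCFVar p.K)) : MeasurableSpace Ω :=
  ⨆ v ∈ S, MeasurableSpace.comap (dcfFamily M.κ M.η M.X v) inferInstance

lemma sigma_le (S : Set (DCFVar p.K)) : M.sigma S ≤ ‹MeasurableSpace Ω› :=
  iSup₂_le fun v _ => (M.measurable_dcfFamily v).comap_le

lemma measurable_family_sigma {S : Set (DCFVar p.K)} {v : DCFVar p.K} (hv : v ∈ S) :
    Measurable[M.sigma S] (dcfFamily M.κ M.η M.X v) :=
  Measurable.of_comap_le (le_iSup₂_of_le (f := fun v (_ : v ∈ S) =>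
    MeasurableSpace.comap (dcfFamily M.κ M.η M.X v) inferInstance) v hv le_rfl)

lemma measurable_X_sigma {S : Set (DCFVar p.K)} {i l : ℕ} (h : .slot i l ∈ S) :
    Measurable[M.sigma S] (M.X i l) :=
  M.measurable_family_sigma h

lemma measurable_η_sigma {S : Set (DCFVar p.K)} {i : ℕ} {j : Fin p.K} (h : .backoff i j ∈ S) :
    Measurable[M.sigma S] (M.η i j) := by
  refine @measurable_to_countable' _ _ _ _ (M.sigma S) _ fun w => ?_
  have : M.η i j ⁻¹' {w} = dcfFamily M.κ M.η M.X (.backoff i j) ⁻¹' {(w : ℝ)} := by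
    ext ω; simp [dcfFamily]
  rw [this]
  exact M.measurable_family_sigma h (measurableSet_singleton _)

lemma measurable_κ_sigma {S : Set (DCFVar p.K)} {i : ℕ} (h : .collisions i ∈ S) :
    Measurable[M.sigma S] (M.κ i) := by
  refine @measurable_to_countable' _ _ _ _ (M.sigma S) _ fun w => ?_
  have : M.κ i ⁻¹' {w} = dcfFamily M.κ M.η M.X (.collisions i) ⁻¹' {((w : ℕ) : ℝ)} := by
    ext ω; simp [dcfFamily, Fin.ext_iff]
  rw [this]
  exact M.measurable_family_sigma h (measurableSet_singleton _)

/-- The off-period that an elementary variable belongs to. -/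
def period {K : ℕ} : DCFVar K → ℕ
  | .collisions i => i
  | .backoff i _ => i
  | .slot i _ => i

lemma measurable_offTime_sigma {S : Set (DCFVar p.K)} {i : ℕ} (h : ∀ v, period v = i → v ∈ S) :
    Measurable[M.sigma S] (M.offTime i) :=
  @measurable_compoundTime Ω (M.sigma S) p.K (M.κ i) (M.η i) (M.X i) p.tc
    (M.measurable_κ_sigma (h _ rfl)) (fun _ => M.measurable_η_sigma (h _ rfl))
    (fun _ => M.measurable_X_sigma (h _ rfl))

lemma measurable_offTime (i : ℕ) : Measurable (M.offTime i) :=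
  measurable_compoundTime p.tc (M.measurable_κ i) (M.measurable_η i) (M.measurable_X i)

/-- Disjoint groups of independent variables generate independent σ-algebras. The product formula
for independent functions needs no integrability, so measurability suffices. -/
lemma integral_mul_of_disjoint {S T : Set (DCFVar p.K)} (hST : Disjoint S T) {f g : Ω → ℝ}
    (hf : Measurable[M.sigma S] f) (hg : Measurable[M.sigma T] g) :
    ∫ ω, f ω * g ω ∂μ = (∫ ω, f ω ∂μ) * ∫ ω, g ω ∂μ := by
  have hi : Indep (M.sigma S) (M.sigma T) μ :=
    indep_iSup_of_disjoint (fun v => (M.measurable_dcfFamily v).comap_le)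
      ((iIndepFun_iff_iIndep _ _ _).1 M.indep) hST
  have : f ⟂ᵢ[μ] g := (IndepFun_iff_Indep _ _ _).2
    (indep_of_indep_of_le_left (indep_of_indep_of_le_right hi hg.comap_le) hf.comap_le)
  exact this.integral_fun_mul_eq_mul_integral
    (hf.mono (M.sigma_le S) le_rfl).aestronglyMeasurable
    (hg.mono (M.sigma_le T) le_rfl).aestronglyMeasurable

lemma integral_prod_of_injective [IsProbabilityMeasure μ] {ι : Type*} {v : ι → DCFVar p.K}
    (hv : Function.Injective v)
    {f : ι → Ω → ℝ} (hf : ∀ j, Measurable[M.sigma {v j}] (f j)) (s : Finset ι) :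
    ∫ ω, ∏ j ∈ s, f j ω ∂μ = ∏ j ∈ s, ∫ ω, f j ω ∂μ := by
  classical
  induction s using Finset.induction_on with
  | empty => simp
  | insert a s ha ih =>
    simp only [Finset.prod_insert ha]
    rw [M.integral_mul_of_disjoint (S := {v a}) (T := v '' s) _ (hf a), ih]
    · refine Finset.measurable_prod _ fun j hj => (hf j).mono ?_ le_rfl
      exact biSup_mono fun w hw => by
        rw [Set.mem_singleton_iff] at hw
        exact hw ▸ ⟨j, hj, rfl⟩
    · rw [Set.disjoint_singleton_left]
      rintro ⟨j, hj, h⟩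
      exact ha (hv h ▸ hj)

lemma ae_X_mem (i l : ℕ) : ∀ᵐ ω ∂μ, M.X i l ω ∈ Set.Icc 0 p.slotMax := by
  have h : ∀ᵐ x ∂p.slotLaw, x ∈ Set.Icc 0 p.slotMax := by
    have hd (x : ℝ) (c : ENNReal) (hx : x ∈ Set.Icc 0 p.slotMax) :
        ∀ᵐ y ∂(c • Measure.dirac x), y ∈ Set.Icc 0 p.slotMax :=
      Measure.ae_smul_measure ((ae_dirac_iff measurableSet_Icc).2 hx) c
    unfold DCFParams.slotLaw
    rw [ae_add_measure_iff, ae_add_measure_iff]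
    exact ⟨⟨hd _ _ ⟨p.σ_pos.le, le_max_left _ _⟩,
      hd _ _ ⟨p.ts_pos.le, (le_max_left _ _).trans (le_max_right _ _)⟩⟩,
      hd _ _ ⟨p.tc_pos.le, (le_max_right _ _).trans (le_max_right _ _)⟩⟩
  rw [← M.law_X i l] at h
  exact ae_of_ae_map (M.measurable_X i l).aemeasurable h

lemma realPGF_X {z : ℝ} (i l : ℕ) : realPGF μ (M.X i l) z = p.slotExpr z := by
  have h := integral_map (μ := μ) (M.measurable_X i l).aemeasurable
    (f := fun x : ℝ => z ^ x)
    (Measurable.aestronglyMeasurable (measurable_const.pow measurable_id))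
  unfold realPGF
  rw [← h, M.law_X, p.integral_slotLaw]
  rfl

/-- The prescribed masses of the values below `p.W j` already add up to one. -/
lemma ae_η_lt [IsProbabilityMeasure μ] (i : ℕ) (j : Fin p.K) :
    ∀ᵐ ω ∂μ, M.η i j ω < p.W j := by
  have hm : MeasurableSet {ω | M.η i j ω < p.W j} :=
    measurableSet_lt (M.measurable_η i j) measurable_const
  have hr : μ.real {ω | M.η i j ω < p.W j} = 1 := by
    have : {ω | M.η i j ω < p.W j} = ⋃ w ∈ Finset.range (p.W j), {ω | M.η i j ω = w} := by
      ext ω; simp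
    rw [this, measureReal_biUnion_finset]
    · rw [Finset.sum_congr rfl fun w hw => M.law_η i j w (Finset.mem_range.1 hw)]
      have := p.W_pos j
      simp [this.ne']
    · intro a _ b _ hab
      exact Set.disjoint_left.2 fun ω ha hb => hab (ha.symm.trans hb)
    · exact fun w _ => M.measurable_η i j (measurableSet_singleton w)
  rw [ae_iff, ← Set.compl_ofPred, prob_compl_eq_zero_iff hm]
  rwa [measureReal_def, ENNReal.toReal_eq_one_iff] at hr

lemma ae_offTime_mem [IsProbabilityMeasure μ] (i : ℕ) :
    ∀ᵐ ω ∂μ, M.offTime i ω ∈ Set.Icc 0 p.offMax := by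
  filter_upwards [ae_all_iff.2 fun l => M.ae_X_mem i l, ae_all_iff.2 fun j => M.ae_η_lt i j]
    with ω hX hη
  have hB : M.backoffSlots i ω ≤ p.backoffMax :=
    (Finset.sum_le_sum fun j _ => (hη j).le).trans
      (Finset.sum_le_sum_of_subset (Finset.subset_univ _))
  have hκ : ((M.κ i ω : ℕ) : ℝ) ≤ p.K := by exact_mod_cast (M.κ i ω).2.le
  refine ⟨add_nonneg (mul_nonneg (Nat.cast_nonneg _) p.tc_pos.le)
    (Finset.sum_nonneg fun l _ => (hX l).1), add_le_add
    (mul_le_mul_of_nonneg_right hκ p.tc_pos.le) ?_⟩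
  calc ∑ l ∈ Finset.range (M.backoffSlots i ω), M.X i l ω
      ≤ ∑ l ∈ Finset.range (M.backoffSlots i ω), p.slotMax := Finset.sum_le_sum fun l _ => (hX l).2
    _ = M.backoffSlots i ω * p.slotMax := by simp
    _ ≤ p.backoffMax * p.slotMax :=
      mul_le_mul_of_nonneg_right (by exact_mod_cast hB) p.slotMax_nonneg

end DCFModel

/-! ### Expectations split along the values of a random index. -/

section Expectations

variable {Ω : Type*} [MeasurableSpace Ω] {μ : Measure Ω}

lemma integrable_rpow_of_mem_Icc [IsFiniteMeasure μ] {Y : Ω → ℝ} {a b z : ℝ} (hz : 0 < z)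
    (hY : Measurable Y) (h : ∀ᵐ ω ∂μ, Y ω ∈ Set.Icc a b) : Integrable (fun ω => z ^ Y ω) μ := by
  simp only [Real.rpow_def_of_pos hz]
  exact integrable_exp_mul_of_mem_Icc hY.aemeasurable h

lemma integral_eq_sum_indicator {N : Ω → ℕ} (hN : Measurable N) {n : ℕ}
    (hn : ∀ᵐ ω ∂μ, N ω < n) {f : ℕ → Ω → ℝ} (hf : ∀ w, Integrable (f w) μ) :
    ∫ ω, f (N ω) ω ∂μ = ∑ w ∈ Finset.range n, ∫ ω, {ω | N ω = w}.indicator 1 ω * f w ω ∂μ := by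
  classical
  rw [← integral_finsetSum]
  · refine integral_congr_ae ?_
    filter_upwards [hn] with ω hω
    simp [Set.indicator_apply, hω]
  · intro w _
    have : (fun ω => {ω | N ω = w}.indicator 1 ω * f w ω) = {ω | N ω = w}.indicator (f w) := by
      ext ω; simp [Set.indicator_apply]
    rw [this]
    exact (hf w).indicator (hN (measurableSet_singleton w))

lemma integral_indicator_natEq {N : Ω → ℕ} (hN : Measurable N) (w : ℕ) :
    ∫ ω, {ω | N ω = w}.indicator 1 ω ∂μ = μ.real {ω | N ω = w} :=
  integral_indicator_one (hN (measurableSet_singleton w))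

lemma integral_comp_nat [IsFiniteMeasure μ] {N : Ω → ℕ} (hN : Measurable N) {n : ℕ}
    (hn : ∀ᵐ ω ∂μ, N ω < n) (f : ℕ → ℝ) :
    ∫ ω, f (N ω) ∂μ = ∑ w ∈ Finset.range n, μ.real {ω | N ω = w} * f w := by
  rw [integral_eq_sum_indicator hN hn (f := fun w _ => f w) fun w => integrable_const _]
  refine Finset.sum_congr rfl fun w _ => ?_
  rw [integral_mul_const, integral_indicator_natEq hN]

end Expectations

namespace DCFParams

variable (p : DCFParams)

lemma sum_pow_eq_backoffExpr (j : ℕ) (z : ℝ) :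
    ∑ w ∈ Finset.range (p.W j), 1 / (p.W j : ℝ) * z ^ w = p.backoffExpr j z := by
  have hW : (p.W j : ℝ) ≠ 0 := by exact_mod_cast (p.W_pos j).ne'
  unfold backoffExpr
  split_ifs with h
  · simp [h, hW]
  · rw [← Finset.mul_sum, geom_sum_eq h, ← neg_sub (1 : ℝ), ← neg_sub (1 : ℝ) z, neg_div_neg_eq]

end DCFParams

/-! ### Generating functions of the timers and of the off-period. -/

namespace DCFModel

variable {Ω : Type*} [MeasurableSpace Ω] {p : DCFParams} {μ : Measure Ω} [IsProbabilityMeasure μ]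
  (M : DCFModel p μ)

lemma integral_pow_η (z : ℝ) (i : ℕ) (j : Fin p.K) :
    ∫ ω, z ^ M.η i j ω ∂μ = p.backoffExpr j z := by
  rw [integral_comp_nat (M.measurable_η i j) (M.ae_η_lt i j) (fun w => z ^ w),
    ← p.sum_pow_eq_backoffExpr]
  exact Finset.sum_congr rfl fun w hw => by rw [M.law_η i j w (Finset.mem_range.1 hw)]

lemma integrable_η {z : ℝ} (hz : 0 < z) (i : ℕ) (j : Fin p.K) :
    Integrable (fun ω => z ^ (M.η i j ω : ℝ)) μ := by
  refine integrable_rpow_of_mem_Icc (a := 0) (b := p.W j) hz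
    (M.measurable_dcfFamily (.backoff i j)) ?_
  filter_upwards [M.ae_η_lt i j] with ω h
  exact ⟨Nat.cast_nonneg _, by exact_mod_cast h.le⟩

lemma integrable_offTime {z : ℝ} (hz : 0 < z) (i : ℕ) :
    Integrable (fun ω => z ^ M.offTime i ω) μ :=
  integrable_rpow_of_mem_Icc hz (M.measurable_offTime i) (M.ae_offTime_mem i)

lemma integral_prod_slots {z : ℝ} (i b : ℕ) :
    ∫ ω, ∏ l ∈ Finset.range b, z ^ M.X i l ω ∂μ = p.slotExpr z ^ b := by
  rw [M.integral_prod_of_injective (v := fun l => DCFVar.slot i l)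
    (f := fun l ω => z ^ M.X i l ω)]
  · have h (l : ℕ) : ∫ ω, z ^ M.X i l ω ∂μ = p.slotExpr z := M.realPGF_X i l
    simp [h]
  · intro a b h
    simpa using h
  · exact fun l => (measurable_const.pow measurable_id).comp
      (M.measurable_X_sigma (Set.mem_singleton _))

lemma integrable_prod_slots {z : ℝ} (hz : 0 < z) (i b : ℕ) :
    Integrable (fun ω => ∏ l ∈ Finset.range b, z ^ M.X i l ω) μ := by
  simp only [← Real.rpow_sum_of_pos hz]
  refine integrable_rpow_of_mem_Icc (a := 0) (b := b * p.slotMax) hz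
    (Finset.measurable_sum _ fun l _ => M.measurable_X i l) ?_
  filter_upwards [ae_all_iff.2 fun l => M.ae_X_mem i l] with ω h
  refine ⟨Finset.sum_nonneg fun l _ => (h l).1, ?_⟩
  simpa using Finset.sum_le_sum fun l (_ : l ∈ Finset.range b) => (h l).2

/-- Expectation of `z` to the duration of the slots backed off in the attempts `j ≤ k`. -/
lemma integral_prod_backoff {z : ℝ} (hz : 0 < z) (i : ℕ) (k : Fin p.K) :
    ∫ ω, ∏ l ∈ Finset.range (∑ j ∈ Finset.Iic k, M.η i j ω), z ^ M.X i l ω ∂μ =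
      ∏ j ∈ Finset.Iic k, p.backoffExpr j (p.slotExpr z) := by
  have hm : Measurable fun ω => ∑ j ∈ Finset.Iic k, M.η i j ω :=
    Finset.measurable_sum _ fun j _ => M.measurable_η i j
  have hlt : ∀ᵐ ω ∂μ, ∑ j ∈ Finset.Iic k, M.η i j ω < p.backoffMax + 1 := by
    filter_upwards [ae_all_iff.2 fun j => M.ae_η_lt i j] with ω h
    exact Nat.lt_succ_of_le ((Finset.sum_le_sum fun j _ => (h j).le).trans
      (Finset.sum_le_sum_of_subset (Finset.subset_univ _)))
  have hη := M.integral_prod_of_injective (v := fun j => DCFVar.backoff i j)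
    (f := fun j ω => p.slotExpr z ^ M.η i j ω) (fun a b h => by simpa using h)
    (fun j => (measurable_of_countable fun n : ℕ => p.slotExpr z ^ n).comp
      (M.measurable_η_sigma (Set.mem_singleton _))) (Finset.Iic k)
  simp only [integral_pow_η, Finset.prod_pow_eq_pow_sum] at hη
  -- Both sides become sums over the total number `b` of slots. They agree term by term, since the
  -- timers are independent of the slot durations.
  rw [integral_eq_sum_indicator hm hlt
    (f := fun b ω => ∏ l ∈ Finset.range b, z ^ M.X i l ω) (M.integrable_prod_slots hz i), ← hη,
    integral_comp_nat hm hlt fun n => p.slotExpr z ^ n]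
  refine Finset.sum_congr rfl fun b _ => ?_
  rw [M.integral_mul_of_disjoint (S := Set.range fun j => DCFVar.backoff i j)
    (T := Set.range fun l => DCFVar.slot i l), M.integral_prod_slots,
    integral_indicator_natEq hm]
  · rw [Set.disjoint_left]
    rintro _ ⟨j, rfl⟩ ⟨l, h⟩
    cases h
  · refine Measurable.indicator measurable_const ?_
    exact (Finset.measurable_sum (Finset.Iic k) fun j _ =>
      M.measurable_η_sigma (Set.mem_range_self j)) (measurableSet_singleton b)
  · exact Finset.measurable_prod _ fun l _ => (measurable_const.pow measurable_id).comp
      (M.measurable_X_sigma (Set.mem_range_self l))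

/-- On the event that there are `k` collisions, the duration is `k * p.tc` plus the slots of
attempts `0, …, k`, and these are independent of the event. -/
lemma realPGF_offTime {z : ℝ} (hz : 0 < z) (i : ℕ) :
    realPGF μ (M.offTime i) z = p.offExpr z := by
  have hsplit : realPGF μ (M.offTime i) z = ∑ k : Fin p.K,
      ∫ ω, {ω | M.κ i ω = k}.indicator (fun _ => z ^ (((k : ℕ) : ℝ) * p.tc)) ω *
        ∏ l ∈ Finset.range (∑ j ∈ Finset.Iic k, M.η i j ω), z ^ M.X i l ω ∂μ := by
    have hpt (k : Fin p.K) :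
        (fun ω => {ω | M.κ i ω = k}.indicator (fun _ => z ^ (((k : ℕ) : ℝ) * p.tc)) ω *
          ∏ l ∈ Finset.range (∑ j ∈ Finset.Iic k, M.η i j ω), z ^ M.X i l ω) =
        {ω | M.κ i ω = k}.indicator (fun ω => z ^ M.offTime i ω) := by
      ext ω
      by_cases h : M.κ i ω = k
      · subst h
        simp [offTime, backoffSlots, Real.rpow_add hz, Real.rpow_sum_of_pos hz]
      · simp [h]
    simp only [hpt]
    rw [← integral_finsetSum]
    · refine integral_congr_ae (.of_forall fun ω => ?_)
      simp [Set.indicator_apply]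
    · exact fun k _ => (M.integrable_offTime hz i).indicator
        (M.measurable_κ i (measurableSet_singleton k))
  rw [hsplit, DCFParams.offExpr, Finset.sum_range]
  refine Finset.sum_congr rfl fun k _ => ?_
  rw [M.integral_mul_of_disjoint (S := {DCFVar.collisions i})
    (T := {v | v ≠ DCFVar.collisions i}), M.integral_prod_backoff hz,
    integral_indicator_const (s := {ω | M.κ i ω = k}) _
      (M.measurable_κ i (measurableSet_singleton k))]
  · congr 1
    · exact congrArg (· * z ^ (((k : ℕ) : ℝ) * p.tc)) (M.law_κ i k)
    · refine Finset.prod_nbij (fun j : Fin p.K => (j : ℕ)) ?_ ?_ ?_ ?_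
      · intro j hj
        exact Finset.mem_range.2 (Nat.lt_succ_of_le (show j ≤ k from Finset.mem_Iic.1 hj))
      · exact fun a _ b _ h => Fin.ext h
      · intro n hn
        have hn' : n < (k : ℕ) + 1 := Finset.mem_range.1 hn
        exact ⟨⟨n, by omega⟩, by simp [Fin.le_def]; omega, rfl⟩
      · exact fun _ _ => rfl
  · rw [Set.disjoint_singleton_left]; simp
  · exact Measurable.indicator measurable_const
      (M.measurable_κ_sigma (Set.mem_singleton _) (measurableSet_singleton k))
  · refine @measurable_comp_countable Ω (M.sigma {v | v ≠ DCFVar.collisions i}) ℕ ℝ _ _ _ _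
      (fun ω => ∑ j ∈ Finset.Iic k, M.η i j ω)
      (fun b ω => ∏ l ∈ Finset.range b, z ^ M.X i l ω) ?_ ?_
    · exact Finset.measurable_sum (Finset.Iic k) fun j _ => M.measurable_η_sigma nofun
    · exact fun b => Finset.measurable_prod _ fun l _ =>
        (measurable_const.pow measurable_id).comp (M.measurable_X_sigma nofun)

end DCFModel

/-! ### Spectral radius of an antidiagonal matrix. -/

lemma spectrum_antidiagonal (a b : ℂ) :
    spectrum ℂ (!![0, a; b, 0] : Matrix (Fin 2) (Fin 2) ℂ) = {x | x ^ 2 = a * b} := by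
  ext x
  rw [Matrix.mem_spectrum_iff_isRoot_charpoly, Matrix.charpoly_fin_two]
  simp [Matrix.trace_fin_two, Matrix.det_fin_two, Polynomial.IsRoot, sub_eq_zero,
    ← sub_eq_add_neg]

lemma spectralRadius_antidiagonal_eq_one_iff {a b : ℝ} (ha : 0 ≤ a) (hb : 0 ≤ b) :
    spectralRadius ℂ (!![0, (a : ℂ); (b : ℂ), 0] : Matrix (Fin 2) (Fin 2) ℂ) = 1 ↔
      a * b = 1 := by
  have hs : spectralRadius ℂ (!![0, (a : ℂ); (b : ℂ), 0] : Matrix (Fin 2) (Fin 2) ℂ) =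
      ENNReal.ofReal (√(a * b)) := by
    rw [spectralRadius, spectrum_antidiagonal]
    refine le_antisymm (iSup₂_le fun x hx => ?_) ?_
    · have h2 : ‖x‖ ^ 2 = a * b := by
        rw [← norm_pow, hx, ← Complex.ofReal_mul, Complex.norm_real,
          Real.norm_of_nonneg (mul_nonneg ha hb)]
      rw [← h2, Real.sqrt_sq (norm_nonneg x), ofReal_norm]
      rfl
    · refine le_iSup₂_of_le ((√(a * b) : ℝ) : ℂ) ?_ ?_
      · show ((√(a * b) : ℝ) : ℂ) ^ 2 = a * b
        exact_mod_cast Real.sq_sqrt (mul_nonneg ha hb)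
      · rw [← Real.norm_of_nonneg (Real.sqrt_nonneg (a * b)), ← Complex.norm_real,
          ofReal_norm]
        simp [enorm]
  rw [hs, ENNReal.ofReal_eq_one, Real.sqrt_eq_one]

/-! ### Inversion of `F` and the spectral equation. -/

namespace DCFModel

variable {Ω : Type*} [MeasurableSpace Ω] {p : DCFParams} {μ : Measure Ω} (M : DCFModel p μ)

lemma offPGF_exp (x : ℝ) : M.offPGF (Real.exp x) = mgf (M.offTime 0) μ x := by
  simp only [offPGF, realPGF, mgf, ← Real.exp_mul]

lemma H_eq (r s u : ℝ) : (M.H r s u).map (fun a => (a : ℂ)) =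
    !![0, (M.offPGF (Real.exp (-u)) : ℂ); (Real.exp ((r * s - u) * p.ts) : ℂ), 0] := by
  ext i j
  fin_cases i <;> fin_cases j <;>
    simp [H, Gam, onOffTransition, Matrix.mul_apply, Fin.sum_univ_two]

variable [IsProbabilityMeasure μ]

lemma integrable_exp_offTime (i : ℕ) (x : ℝ) :
    Integrable (fun ω => Real.exp (x * M.offTime i ω)) μ :=
  integrable_exp_mul_of_mem_Icc (M.measurable_offTime i).aemeasurable (M.ae_offTime_mem i)

lemma offPGF_exp_pos (x : ℝ) : 0 < M.offPGF (Real.exp x) := by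
  rw [offPGF_exp]
  exact mgf_pos (M.integrable_exp_offTime 0 x)

lemma monotone_offPGF_exp : Monotone fun x => M.offPGF (Real.exp x) := by
  intro x y hxy
  simp only [offPGF_exp]
  refine integral_mono_ae (M.integrable_exp_offTime 0 x) (M.integrable_exp_offTime 0 y) ?_
  filter_upwards [M.ae_offTime_mem 0] with ω h
  exact Real.exp_le_exp.2 (mul_le_mul_of_nonneg_right hxy h.1)

/-- The log-MGF of a nonnegative variable is nondecreasing, so the linear term alone guarantees the
growth. This yields strict monotonicity and both infinite limits. -/
lemma F_add_le {x y : ℝ} (hxy : x ≤ y) : M.F x + (y - x) * p.ts ≤ M.F y := by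
  have := Real.log_le_log (M.offPGF_exp_pos x) (M.monotone_offPGF_exp hxy)
  unfold F
  linarith

lemma F_zero : M.F 0 = 0 := by
  simp [F, offPGF, realPGF]

lemma strictMono_F : StrictMono M.F := fun x y hxy => by
  nlinarith [M.F_add_le hxy.le, mul_pos (sub_pos.2 hxy) p.ts_pos]

lemma continuous_F : Continuous M.F := by
  have h : Continuous fun x => M.offPGF (Real.exp x) := by
    simp only [offPGF_exp]
    exact continuous_mgf (M.integrable_exp_offTime 0)
  exact (h.log fun x => (M.offPGF_exp_pos x).ne').add (continuous_id.mul continuous_const)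

lemma bijective_F : Function.Bijective M.F := by
  refine ⟨M.strictMono_F.injective, M.continuous_F.surjective ?_ ?_⟩
  · refine tendsto_atTop_mono' _ ?_ (tendsto_id.atTop_mul_const p.ts_pos)
    filter_upwards [eventually_ge_atTop 0] with x hx
    simpa [F_zero] using M.F_add_le hx
  · refine tendsto_atBot_mono' _ ?_ (tendsto_id.atBot_mul_const p.ts_pos)
    filter_upwards [eventually_le_atBot 0] with x hx
    have := M.F_add_le hx
    rw [F_zero] at this
    simp only [id]
    linarith

lemma F_invFun (a : ℝ) : M.F (Function.invFun M.F a) = a :=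
  Function.invFun_eq (M.bijective_F.2 a)

lemma phi_eq_one_iff {r θ : ℝ} (hθ : 0 < θ) (C : ℝ) :
    M.phi r (-θ) (-θ * C) = 1 ↔ C = 1 / θ * Function.invFun M.F (θ * r * p.ts) := by
  rw [phi, H_eq, spectralRadius_antidiagonal_eq_one_iff (M.offPGF_exp_pos _).le
    (Real.exp_pos _).le]
  have hF : M.offPGF (Real.exp (-(-θ * C))) * Real.exp ((r * -θ - -θ * C) * p.ts) =
      Real.exp (M.F (θ * C) - θ * r * p.ts) := by
    rw [F, Real.exp_sub, Real.exp_add, Real.exp_log (M.offPGF_exp_pos _), mul_div_assoc,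
      ← Real.exp_sub, neg_mul, neg_neg]
    ring_nf
  rw [hF, Real.exp_eq_one_iff, sub_eq_zero]
  constructor
  · intro h
    rw [← h, Function.leftInverse_invFun M.bijective_F.1]
    field_simp
  · rintro rfl
    rw [← mul_assoc, mul_one_div_cancel hθ.ne', one_mul, F_invFun]

end DCFModel

/-! ### Paths of the renewal process and the time spent in "on". -/

/-- Here `N + 1` is the first index at which `T` exceeds `t`. By monotonicity the terms that survive
are exactly those with `n ≤ N`, and they telescope; this evaluates the stopped martingale pathwise.
-/
lemma exists_first_passage {T : ℕ → ℝ} (hT : Monotone T) {t : ℝ} {m : ℕ} (h0 : T 0 ≤ t)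
    (hm : t < T m) (g : ℕ → ℝ) :
    ∃ N, T N ≤ t ∧ t < T (N + 1) ∧
      ∑ n ∈ Finset.range m, (if T n ≤ t then g (n + 1) - g n else 0) = g (N + 1) - g 0 := by
  classical
  have hex : ∃ n, t < T n := ⟨m, hm⟩
  obtain ⟨N, hN⟩ : ∃ N, Nat.find hex = N + 1 := Nat.exists_eq_succ_of_ne_zero fun h => by
    have := Nat.find_spec hex
    rw [h] at this
    exact this.not_ge h0
  have hlt : t < T (N + 1) := hN ▸ Nat.find_spec hex
  have hle (n : ℕ) (hn : n < N + 1) : T n ≤ t := not_lt.1 (Nat.find_min hex (hN ▸ hn))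
  refine ⟨N, hle N N.lt_succ_self, hlt, ?_⟩
  have hNm : N + 1 ≤ m := hN ▸ Nat.find_min' hex hm
  rw [← Finset.sum_range_sub g, ← Finset.sum_subset (Finset.range_mono hNm)]
  · exact Finset.sum_congr rfl fun n hn => if_pos (hle n (Finset.mem_range.1 hn))
  · intro n _ hn
    exact if_neg (hlt.trans_le (hT (not_lt.1 fun h => hn (Finset.mem_range.2 h)))).not_ge

/-- Bounds on the time covered in `[0, t)` by one interval of length `d` in each of the
consecutive cycles `[T n, T (n + 1))`. -/
lemma volume_iUnion_Ico_bounds {T a : ℕ → ℝ} {d t : ℝ} (hd : 0 ≤ d) (h0 : T 0 = 0)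
    (ha : ∀ n, T n ≤ a n) (hb : ∀ n, a n + d ≤ T (n + 1)) {N : ℕ} (hN : T N ≤ t)
    (hN' : t < T (N + 1)) :
    volume.real ((⋃ n, Set.Ico (a n) (a n + d)) ∩ Set.Ico 0 t) ∈ Set.Icc (N * d) ((N + 1) * d) := by
  have hT : Monotone T := monotone_nat_of_le_succ fun n => by linarith [ha n, hb n]
  have hlen (n : ℕ) : volume.real (Set.Ico (a n) (a n + d)) = d := by
    rw [Real.volume_real_Ico_of_le (by linarith)]; ring
  constructor
  · have hdisj : Pairwise (Function.onFun Disjoint fun n => Set.Ico (a n) (a n + d)) := by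
      refine (pairwise_disjoint_on _).2 fun m n hmn => Set.disjoint_left.2 fun s hs hs' => ?_
      have := hT (Nat.succ_le_of_lt hmn)
      simp only [Nat.succ_eq_add_one] at this
      linarith [hs.2, hs'.1, hb m, ha n]
    -- The first `N` cycles end by time `t`, so their intervals count in full.
    have hsub : (⋃ n ∈ Finset.range N, Set.Ico (a n) (a n + d)) ⊆
        (⋃ n, Set.Ico (a n) (a n + d)) ∩ Set.Ico 0 t := by
      refine Set.iUnion₂_subset fun n hn s hs => ⟨Set.mem_iUnion.2 ⟨n, hs⟩, ?_, ?_⟩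
      · linarith [hT (Nat.zero_le n), ha n, hs.1]
      · have := hT (Nat.succ_le_of_lt (Finset.mem_range.1 hn))
        simp only [Nat.succ_eq_add_one] at this
        linarith [hs.2, hb n]
    calc (N : ℝ) * d = volume.real (⋃ n ∈ Finset.range N, Set.Ico (a n) (a n + d)) := by
          rw [measureReal_biUnion_finset (fun _ _ _ _ h => hdisj h) (fun _ _ => measurableSet_Ico)
            fun _ _ => by simp]
          simp [hlen]
      _ ≤ _ := measureReal_mono hsub
        (measure_ne_top_of_subset Set.inter_subset_right (by simp))
  -- Cycles from index `N + 1` onwards start after `t`.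
  · have hsub : (⋃ n, Set.Ico (a n) (a n + d)) ∩ Set.Ico 0 t ⊆
        ⋃ n ∈ Finset.range (N + 1), Set.Ico (a n) (a n + d) := by
      rintro s ⟨hs, hst⟩
      obtain ⟨n, hn⟩ := Set.mem_iUnion.1 hs
      refine Set.mem_iUnion₂.2 ⟨n, Finset.mem_range.2 (not_le.1 fun h => ?_), hn⟩
      linarith [hT h, ha n, hn.1, hst.2]
    have hfin : volume (⋃ n ∈ Finset.range (N + 1), Set.Ico (a n) (a n + d)) ≠ ⊤ :=
      ((measure_biUnion_lt_top (Finset.finite_toSet _) fun _ _ => by simp)).ne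
    calc _ ≤ volume.real (⋃ n ∈ Finset.range (N + 1), Set.Ico (a n) (a n + d)) :=
          measureReal_mono hsub hfin
      _ ≤ ∑ n ∈ Finset.range (N + 1), volume.real (Set.Ico (a n) (a n + d)) :=
          measureReal_biUnion_finset_le _ _
      _ = (N + 1) * d := by simp [hlen]

namespace DCFModel

variable {Ω : Type*} [MeasurableSpace Ω] {p : DCFParams} {μ : Measure Ω} (M : DCFModel p μ)

lemma service_eq (r t : ℝ) (ω : Ω) (h : MeasurableSet (M.onTimes ω)) :
    M.service r t ω = r * volume.real (M.onTimes ω ∩ Set.Ico 0 t) := by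
  rw [service, integral_indicator_const _ h, measureReal_restrict_apply h, smul_eq_mul, mul_comm]

lemma offVisits_succ (m : ℕ) (ω : Ω) :
    M.offVisits (m + 1) ω = M.offVisits m ω + if M.J m ω = 0 then 1 else 0 := by
  simp only [offVisits, Finset.card_filter, Finset.sum_range_succ]

lemma measurable_offVisits (m : ℕ) : Measurable (M.offVisits m) := by
  have : M.offVisits m = fun ω => ∑ l ∈ Finset.range m, if M.J l ω = 0 then 1 else 0 := by
    ext ω; simp only [offVisits, Finset.card_filter]
  rw [this]
  exact Finset.measurable_sum _ fun l _ => Measurable.ite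
    (M.measurable_J l (measurableSet_singleton 0)) measurable_const measurable_const

lemma measurable_jumpTime (m : ℕ) : Measurable (M.jumpTime m) :=
  Finset.measurable_sum _ fun l _ => Measurable.ite
    (M.measurable_J l (measurableSet_singleton 0))
    (measurable_comp_countable (M.measurable_offVisits l) M.measurable_offTime) measurable_const

lemma measurable_service (r t : ℝ) : Measurable (M.service r t) := by
  -- Joint measurability in the outcome and the time makes the integral over time measurable in the
  -- outcome.
  have hE : MeasurableSet {q : Ω × ℝ | q.2 ∈ M.onTimes q.1} := by
    have : {q : Ω × ℝ | q.2 ∈ M.onTimes q.1} = ⋃ m, {q : Ω × ℝ | M.J m q.1 = 1} ∩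
        ({q | M.jumpTime m q.1 ≤ q.2} ∩ {q | q.2 < M.jumpTime (m + 1) q.1}) := by
      ext q; simp [onTimes]
    rw [this]
    exact .iUnion fun m => (((M.measurable_J m).comp measurable_fst)
      (measurableSet_singleton 1)).inter
      ((measurableSet_le ((M.measurable_jumpTime m).comp measurable_fst) measurable_snd).inter
        (measurableSet_lt measurable_snd ((M.measurable_jumpTime (m + 1)).comp measurable_fst)))
  have hm : Measurable (Function.uncurry fun ω s => (M.onTimes ω).indicator (fun _ => r) s) :=
    (measurable_const.indicator hE : Measurable
      ({q : Ω × ℝ | q.2 ∈ M.onTimes q.1}.indicator fun _ => r))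
  exact (hm.stronglyMeasurable.integral_prod_right
    (ν := volume.restrict (Set.Ico 0 t))).measurable

/-- End of the `n`-th cycle of an off-period and an on-period. -/
def renewal (n : ℕ) (ω : Ω) : ℝ := ∑ i ∈ Finset.range n, (M.offTime i ω + p.ts)

lemma renewal_zero (ω : Ω) : M.renewal 0 ω = 0 := Finset.sum_range_zero _

lemma renewal_succ (n : ℕ) (ω : Ω) :
    M.renewal (n + 1) ω = M.renewal n ω + (M.offTime n ω + p.ts) := Finset.sum_range_succ _ _

lemma measurable_renewal (n : ℕ) : Measurable (M.renewal n) :=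
  Finset.measurable_sum _ fun i _ => (M.measurable_offTime i).add_const _

/-- The diagonal of the transition matrix vanishes, so each repetition of a state is a null event.
From here on the initial law of `J` and its dependence on the off-periods play no role. -/
lemma ae_alternating [IsFiniteMeasure μ] : ∀ᵐ ω ∂μ, ∀ m, M.J (m + 1) ω ≠ M.J m ω := by
  refine ae_all_iff.2 fun m => ?_
  have h (a : Fin 2) : ∀ᵐ ω ∂μ, ¬ (M.J m ω = a ∧ M.J (m + 1) ω = a) := by
    have := M.transition_J m a a
    rw [show onOffTransition a a = 0 by fin_cases a <;> rfl, mul_zero,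
      measureReal_eq_zero_iff] at this
    rw [ae_iff]
    simpa using this
  filter_upwards [ae_all_iff.2 h] with ω hω he
  exact hω (M.J m ω) ⟨rfl, he⟩

lemma J_even {ω : Ω} (h : ∀ m, M.J (m + 1) ω ≠ M.J m ω) (n : ℕ) : M.J (2 * n) ω = M.J 0 ω := by
  induction n with
  | zero => rfl
  | succ n ih =>
    have h1 := h (2 * n)
    have h2 := h (2 * n + 1)
    rw [show 2 * (n + 1) = 2 * n + 1 + 1 by ring]
    rw [ih] at h1
    omega

lemma jumpTime_succ (m : ℕ) (ω : Ω) :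
    M.jumpTime (m + 1) ω = M.jumpTime m ω + M.sojourn m ω := Finset.sum_range_succ _ _

lemma offVisits_even {ω : Ω} (h : ∀ m, M.J (m + 1) ω ≠ M.J m ω) (n : ℕ) :
    M.offVisits (2 * n) ω = n := by
  induction n with
  | zero => rfl
  | succ n ih =>
    have h1 := h (2 * n)
    rw [show 2 * (n + 1) = 2 * n + 1 + 1 by ring, offVisits_succ, offVisits_succ, ih]
    split_ifs <;> omega

/-- Two consecutive sojourns consist of the next off-period and one on-period, in an order fixed by
the initial state; their sum does not depend on that order. -/
lemma jumpTime_even {ω : Ω} (h : ∀ m, M.J (m + 1) ω ≠ M.J m ω) (n : ℕ) :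
    M.jumpTime (2 * n) ω = M.renewal n ω := by
  induction n with
  | zero => rfl
  | succ n ih =>
    have h1 := h (2 * n)
    rw [show 2 * (n + 1) = 2 * n + 1 + 1 by ring, jumpTime_succ, jumpTime_succ, ih, renewal_succ,
      sojourn, sojourn, offVisits_succ, M.offVisits_even h]
    by_cases h0 : M.J (2 * n) ω = 0
    · have h2 : M.J (2 * n + 1) ω ≠ 0 := by omega
      simp only [h0, h2, if_true, if_false]
      ring
    · have h2 : M.J (2 * n + 1) ω = 0 := by omega
      simp only [h0, h2, if_true, if_false, add_zero]
      ring

/-- Each cycle contains one on-interval: at its end if the process starts in "off", at its beginning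
if it starts in "on". -/
lemma exists_onTimes_eq {ω : Ω} (h : ∀ m, M.J (m + 1) ω ≠ M.J m ω)
    (hoff : ∀ i, 0 ≤ M.offTime i ω) :
    ∃ a : ℕ → ℝ, (∀ n, M.renewal n ω ≤ a n) ∧ (∀ n, a n + p.ts ≤ M.renewal (n + 1) ω) ∧
      M.onTimes ω = ⋃ n, Set.Ico (a n) (a n + p.ts) := by
  have hon (m : ℕ) (hm : M.J m ω = 1) : M.jumpTime (m + 1) ω = M.jumpTime m ω + p.ts := by
    rw [jumpTime_succ, sojourn, if_neg (by omega)]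
  have hmod (m : ℕ) : m = 2 * (m / 2) ∨ m = 2 * (m / 2) + 1 := by omega
  have hsucc (n : ℕ) : M.jumpTime (2 * n + 1 + 1) ω = M.renewal (n + 1) ω :=
    M.jumpTime_even h (n + 1)
  by_cases h0 : M.J 0 ω = 0
  · have hodd (n : ℕ) : M.J (2 * n + 1) ω = 1 := by
      have h1 := h (2 * n)
      rw [M.J_even h, h0] at h1
      omega
    refine ⟨fun n => M.jumpTime (2 * n + 1) ω, fun n => ?_, fun n => ?_, ?_⟩
    · have := hon _ (hodd n)
      rw [hsucc, renewal_succ] at this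
      linarith [hoff n]
    · rw [← hsucc, hon _ (hodd n)]
    · ext s
      simp only [onTimes, Set.mem_ofPred_eq, Set.mem_iUnion, Set.mem_Ico]
      constructor
      · rintro ⟨m, hm, h1, h2⟩
        rcases hmod m with he | he
        · rw [he, M.J_even h, h0] at hm
          omega
        · rw [hon m hm] at h2
          exact ⟨m / 2, he ▸ h1, he ▸ h2⟩
      · rintro ⟨n, h1, h2⟩
        exact ⟨2 * n + 1, hodd n, h1, by rwa [hon _ (hodd n)]⟩
  · have heven (n : ℕ) : M.J (2 * n) ω = 1 := by
      rw [M.J_even h]; omega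
    refine ⟨fun n => M.jumpTime (2 * n) ω, fun n => (M.jumpTime_even h n).ge, fun n => ?_, ?_⟩
    · simp only [M.jumpTime_even h, renewal_succ]
      linarith [hoff n]
    · ext s
      simp only [onTimes, Set.mem_ofPred_eq, Set.mem_iUnion, Set.mem_Ico]
      constructor
      · rintro ⟨m, hm, h1, h2⟩
        rcases hmod m with he | he
        · rw [hon m hm] at h2
          exact ⟨m / 2, he ▸ h1, he ▸ h2⟩
        · have := h (2 * (m / 2))
          rw [← he, heven, hm] at this
          exact absurd rfl this
      · rintro ⟨n, h1, h2⟩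
        exact ⟨2 * n, heven n, h1, by rwa [hon _ (heven n)]⟩

lemma service_mem_Icc {ω : Ω} (h : ∀ m, M.J (m + 1) ω ≠ M.J m ω)
    (hoff : ∀ i, 0 ≤ M.offTime i ω) {r t : ℝ} (hr : 0 ≤ r) {N : ℕ} (hN : M.renewal N ω ≤ t)
    (hN' : t < M.renewal (N + 1) ω) :
    M.service r t ω ∈ Set.Icc (r * (N * p.ts)) (r * ((N + 1) * p.ts)) := by
  obtain ⟨a, ha, hb, he⟩ := M.exists_onTimes_eq h hoff
  have hv := volume_iUnion_Ico_bounds p.ts_pos.le (M.renewal_zero ω) ha hb hN hN'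
  rw [M.service_eq r t ω (he ▸ .iUnion fun _ => measurableSet_Ico), he]
  exact ⟨mul_le_mul_of_nonneg_left hv.1 hr, mul_le_mul_of_nonneg_left hv.2 hr⟩

lemma service_nonneg {r : ℝ} (hr : 0 ≤ r) (t : ℝ) (ω : Ω) : 0 ≤ M.service r t ω :=
  integral_nonneg fun _ => Set.indicator_nonneg (fun _ _ => hr) _

lemma integrable_exp_service [IsFiniteMeasure μ] {r θ : ℝ} (hr : 0 ≤ r) (hθ : 0 < θ) (t : ℝ) :
    Integrable (fun ω => Real.exp (-θ * M.service r t ω)) μ := by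
  refine .of_mem_Icc 0 1 ((M.measurable_service r t).const_mul _).exp.aemeasurable
    (.of_forall fun ω => ⟨(Real.exp_pos _).le, Real.exp_le_one_iff.2 ?_⟩)
  nlinarith [M.service_nonneg hr t ω]

end DCFModel

/-! ### The exponential martingale and the limit. -/

namespace DCFModel

variable {Ω : Type*} [MeasurableSpace Ω] {p : DCFParams} {μ : Measure Ω} (M : DCFModel p μ)

lemma measurable_renewal_sigma (n : ℕ) : Measurable[M.sigma {v | period v < n}] (M.renewal n) :=
  Finset.measurable_sum _ fun i hi => (M.measurable_offTime_sigma fun v hv => by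
    simpa [hv] using hi).add_const _

/-- The exponential martingale of the renewal process. -/
noncomputable def expMart (x : ℝ) (n : ℕ) (ω : Ω) : ℝ := Real.exp (x * M.renewal n ω - n * M.F x)

lemma expMart_succ (x : ℝ) (n : ℕ) (ω : Ω) : M.expMart x (n + 1) ω - M.expMart x n ω =
    M.expMart x n ω * (Real.exp (x * (M.offTime n ω + p.ts) - M.F x) - 1) := by
  unfold expMart
  rw [mul_sub, mul_one, ← Real.exp_add, renewal_succ]
  push_cast
  ring_nf

/-- The exponential martingale stopped at the first renewal after time `t`. -/
noncomputable def stoppedMart (x t : ℝ) (m : ℕ) (ω : Ω) : ℝ :=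
  1 + ∑ n ∈ Finset.range m,
    if M.renewal n ω ≤ t then M.expMart x (n + 1) ω - M.expMart x n ω else 0

lemma stoppedMart_summand (x t : ℝ) (n : ℕ) :
    (fun ω => if M.renewal n ω ≤ t then M.expMart x (n + 1) ω - M.expMart x n ω else 0) =
    {ω | M.renewal n ω ≤ t}.indicator (fun ω => M.expMart x (n + 1) ω - M.expMart x n ω) := by
  classical
  ext ω
  simp [Set.indicator_apply]

variable [IsProbabilityMeasure μ]

lemma ae_renewal_mem (n : ℕ) :
    ∀ᵐ ω ∂μ, M.renewal n ω ∈ Set.Icc (n * p.ts) (n * (p.offMax + p.ts)) := by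
  filter_upwards [ae_all_iff.2 M.ae_offTime_mem] with ω h
  constructor
  · simpa [renewal, Finset.sum_add_distrib] using
      Finset.card_nsmul_le_sum (Finset.range n) (fun i => M.offTime i ω + p.ts) p.ts
      fun i _ => by linarith [(h i).1]
  · simpa [renewal, mul_add, Finset.sum_add_distrib] using
      Finset.sum_le_card_nsmul (Finset.range n) (fun i => M.offTime i ω + p.ts)
      (p.offMax + p.ts) fun i _ => by linarith [(h i).2]

lemma integrable_expMart (x : ℝ) (n : ℕ) : Integrable (M.expMart x n) μ := by
  unfold expMart
  simp only [Real.exp_sub]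
  exact (integrable_exp_mul_of_mem_Icc (M.measurable_renewal n).aemeasurable
    (M.ae_renewal_mem n)).div_const _

/-- `F x` is the logarithm of the MGF of a cycle at `x`, so the normalised factor has mean one. -/
lemma integral_exp_cycle (x : ℝ) (n : ℕ) :
    ∫ ω, (Real.exp (x * (M.offTime n ω + p.ts) - M.F x) - 1) ∂μ = 0 := by
  -- `F` is defined from off-period `0`; passing to period `n` uses that both PGFs equal
  -- `p.offExpr`.
  have hn : ∫ ω, Real.exp (x * M.offTime n ω) ∂μ = M.offPGF (Real.exp x) := by
    rw [offPGF, M.realPGF_offTime (Real.exp_pos x), ← M.realPGF_offTime (Real.exp_pos x) n]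
    simp only [realPGF, ← Real.exp_mul]
  have he : (fun ω => Real.exp (x * (M.offTime n ω + p.ts) - M.F x)) =
      fun ω => Real.exp (x * M.offTime n ω) * Real.exp (x * p.ts - M.F x) := by
    ext ω; rw [← Real.exp_add]; ring_nf
  have hi := (M.integrable_exp_offTime n x).mul_const (Real.exp (x * p.ts - M.F x))
  rw [integral_sub (he ▸ hi) (integrable_const 1), he, integral_mul_const, hn]
  nth_rw 1 [← Real.exp_log (M.offPGF_exp_pos x)]
  rw [← Real.exp_add, F]
  simp

lemma integrable_stoppedMart_summand (x t : ℝ) (n : ℕ) : Integrable (fun ω =>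
    if M.renewal n ω ≤ t then M.expMart x (n + 1) ω - M.expMart x n ω else 0) μ := by
  rw [stoppedMart_summand]
  exact ((M.integrable_expMart x _).sub (M.integrable_expMart x _)).indicator
    (measurableSet_le (M.measurable_renewal n) measurable_const)

lemma integrable_stoppedMart (x t : ℝ) (m : ℕ) : Integrable (M.stoppedMart x t m) μ :=
  (integrable_const 1).add
    (integrable_finsetSum _ fun n _ => M.integrable_stoppedMart_summand x t n)

/-- Optional stopping by hand: whether the `n`-th increment is included depends only on the periods
before `n`, while its new factor depends only on period `n` and has mean zero. -/
lemma integral_stoppedMart (x t : ℝ) (m : ℕ) : ∫ ω, M.stoppedMart x t m ω ∂μ = 1 := by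
  unfold stoppedMart
  rw [integral_add (integrable_const 1)
    (integrable_finsetSum _ fun n _ => M.integrable_stoppedMart_summand x t n),
    integral_finsetSum _ fun n _ => M.integrable_stoppedMart_summand x t n,
    Finset.sum_eq_zero, integral_const]
  · simp
  intro n _
  have h : (fun ω => if M.renewal n ω ≤ t then M.expMart x (n + 1) ω - M.expMart x n ω else 0) =
      fun ω => {ω | M.renewal n ω ≤ t}.indicator (M.expMart x n) ω *
        (Real.exp (x * (M.offTime n ω + p.ts) - M.F x) - 1) := by
    rw [stoppedMart_summand]
    ext ω
    by_cases hω : M.renewal n ω ≤ t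
    · simp [hω, expMart_succ]
    · simp [hω]
  rw [h, M.integral_mul_of_disjoint (S := {v | period v < n}) (T := {v | period v = n}),
    integral_exp_cycle, mul_zero]
  · exact Set.disjoint_left.2 fun v (hv : _ < _) hv' => hv.ne hv'
  · exact Measurable.indicator
      (((M.measurable_renewal_sigma n).const_mul x).sub_const _).exp
      (M.measurable_renewal_sigma n measurableSet_Iic)
  · exact ((((M.measurable_offTime_sigma fun v hv => hv).add_const _).const_mul x).sub_const
      _).exp.sub_const 1

/-- Pathwise comparison of `exp (-θ S(t))` with the stopped martingale. -/
lemma ae_exp_service_bounds {r θ t x : ℝ} (hr : 0 ≤ r) (hθ : 0 < θ) (ht : 0 ≤ t) (hx : 0 ≤ x)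
    (hF : M.F x = θ * r * p.ts) {m : ℕ} (hm : t < m * p.ts) :
    ∀ᵐ ω ∂μ, Real.exp (-θ * M.service r t ω) ∈
      Set.Icc (Real.exp (-(x * (t + (p.offMax + p.ts)))) * M.stoppedMart x t m ω)
        (Real.exp (M.F x - x * t) * M.stoppedMart x t m ω) := by
  filter_upwards [ae_all_iff.2 M.ae_offTime_mem, M.ae_alternating, M.ae_renewal_mem m]
    with ω hoff hJ hren
  have hmono : Monotone fun n => M.renewal n ω := monotone_nat_of_le_succ fun n => by
    rw [renewal_succ]; linarith [(hoff n).1, p.ts_pos]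
  -- Every cycle lasts at least `p.ts`, so `m` cycles outlast `t` and the passage occurs within the
  -- `m` summands.
  obtain ⟨N, h1, h2, h3⟩ := exists_first_passage hmono (t := t) (m := m)
    ((M.renewal_zero ω).le.trans ht) (hm.trans_le hren.1) (fun n => M.expMart x n ω)
  have hZ : M.stoppedMart x t m ω = Real.exp (x * M.renewal (N + 1) ω - (N + 1) * M.F x) := by
    rw [stoppedMart, h3]
    simp [expMart, renewal_zero]
  have hS := M.service_mem_Icc hJ (fun i => (hoff i).1) hr h1 h2
  have h4 : M.renewal (N + 1) ω ≤ t + (p.offMax + p.ts) := by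
    rw [renewal_succ]; linarith [(hoff N).2]
  have h5 := mul_le_mul_of_nonneg_left hS.1 hθ.le
  have h6 := mul_le_mul_of_nonneg_left hS.2 hθ.le
  have h7 := mul_le_mul_of_nonneg_left h4 hx
  have h8 := mul_le_mul_of_nonneg_left h2.le hx
  rw [hZ, ← Real.exp_add, ← Real.exp_add, hF]
  -- `θ * S t` lies between `N * F x` and `(N + 1) * F x`, which explains the spare factor `exp (F
  -- x)` above; below, the loss is the overshoot of `t`, at most one cycle.
  exact ⟨Real.exp_le_exp.2 (by linarith), Real.exp_le_exp.2 (by linarith)⟩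

lemma integral_exp_service_bounds {r θ t x : ℝ} (hr : 0 ≤ r) (hθ : 0 < θ) (ht : 0 ≤ t)
    (hx : 0 ≤ x) (hF : M.F x = θ * r * p.ts) :
    ∫ ω, Real.exp (-θ * M.service r t ω) ∂μ ∈
      Set.Icc (Real.exp (-(x * (t + (p.offMax + p.ts))))) (Real.exp (M.F x - x * t)) := by
  obtain ⟨m, hm⟩ := exists_nat_gt (t / p.ts)
  have hb := M.ae_exp_service_bounds hr hθ ht hx hF ((div_lt_iff₀ p.ts_pos).1 hm)
  have hi := M.integrable_exp_service (μ := μ) hr hθ t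
  have hZ := M.integrable_stoppedMart x t m
  constructor
  · calc _ = ∫ ω, Real.exp (-(x * (t + (p.offMax + p.ts)))) * M.stoppedMart x t m ω ∂μ := by
          rw [integral_const_mul, integral_stoppedMart, mul_one]
      _ ≤ _ := integral_mono_ae (hZ.const_mul _) hi (hb.mono fun _ h => h.1)
  · calc _ ≤ ∫ ω, Real.exp (M.F x - x * t) * M.stoppedMart x t m ω ∂μ :=
          integral_mono_ae hi (hZ.const_mul _) (hb.mono fun _ h => h.2)
      _ = _ := by rw [integral_const_mul, integral_stoppedMart, mul_one]

theorem isEffectiveCapacity {r θ : ℝ} (hr : 0 ≤ r) (hθ : 0 < θ) :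
    IsEffectiveCapacity μ (M.service r) θ (1 / θ * Function.invFun M.F (θ * r * p.ts)) := by
  refine ⟨fun t _ => M.integrable_exp_service hr hθ t, ?_⟩
  set x := Function.invFun M.F (θ * r * p.ts)
  have hF : M.F x = θ * r * p.ts := M.F_invFun _
  have hx : 0 ≤ x := by
    rw [← M.strictMono_F.le_iff_le, hF, F_zero]
    exact mul_nonneg (mul_nonneg hθ.le hr) p.ts_pos.le
  have hlim (c : ℝ) : Tendsto (fun t : ℝ => 1 / θ * x + c / (θ * t)) atTop (𝓝 (1 / θ * x)) := by
    simpa using tendsto_const_nhds.add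
      (tendsto_const_nhds.div_atTop (tendsto_id.const_mul_atTop hθ) : Tendsto
        (fun t : ℝ => c / (θ * t)) atTop (𝓝 0))
  -- Minus the logarithm of the expectation differs from `x * t` by at least `-F x` and at most `x *
  -- (p.offMax + p.ts)`; divided by `θ * t`, both errors vanish.
  refine tendsto_of_tendsto_of_tendsto_of_le_of_le' (hlim (-M.F x))
    (hlim (x * (p.offMax + p.ts))) ?_ ?_
  all_goals
    filter_upwards [eventually_gt_atTop 0] with t ht
    have hb := M.integral_exp_service_bounds (μ := μ) hr hθ ht.le hx hF
    have hpos := (Real.exp_pos _).trans_le hb.1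
    have h1 := (Real.le_log_iff_exp_le hpos).2 hb.1
    have h2 := (Real.log_le_iff_le_exp hpos).2 hb.2
    have hθt : 0 < θ * t := mul_pos hθ ht
    rw [show 1 / θ * x = x * t / (θ * t) by field_simp, ← add_div, neg_mul,
      one_div_mul_eq_div, ← neg_div]
    exact div_le_div_of_nonneg_right (by linarith) hθt.le

end DCFModel

theorem mainTheorem3 {Ω : Type*} [MeasurableSpace Ω] (μ : Measure Ω) [IsProbabilityMeasure μ]
    (p : DCFParams) (M : DCFModel p μ) :
    -- the PGFs of the slot durations, of the backoff timers and of the off-periods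
    (∀ z : ℝ, 0 < z →
      (∀ i l, Integrable (fun ω => z ^ M.X i l ω) μ ∧ realPGF μ (M.X i l) z = p.slotExpr z) ∧
      (∀ i j, Integrable (fun ω => z ^ (M.η i j ω : ℝ)) μ ∧
        realPGF μ (fun ω => (M.η i j ω : ℝ)) z = p.backoffExpr j z) ∧
      (∀ i, Integrable (fun ω => z ^ M.offTime i ω) μ ∧
        realPGF μ (M.offTime i) z = p.offExpr z)) ∧
    -- `F` is increasing and invertible
    StrictMono M.F ∧ Function.Bijective M.F ∧
    -- the effective capacity
    (∀ β γ θ : ℝ, 0 ≤ β → 0 ≤ γ → 0 < θ →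
      IsEffectiveCapacity μ (M.service (β * Real.logb 2 (1 + γ))) θ
        (1 / θ * Function.invFun M.F (β * θ * Real.logb 2 (1 + γ) * p.ts)) ∧
      ∀ C : ℝ, M.phi (β * Real.logb 2 (1 + γ)) (-θ) (-θ * C) = 1 ↔
        C = 1 / θ * Function.invFun M.F (β * θ * Real.logb 2 (1 + γ) * p.ts)) := by
  refine ⟨fun z hz => ⟨fun i l => ⟨integrable_rpow_of_mem_Icc hz (M.measurable_X i l)
      (M.ae_X_mem i l), M.realPGF_X i l⟩, fun i j => ⟨M.integrable_η hz i j, ?_⟩,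
      fun i => ⟨M.integrable_offTime hz i, M.realPGF_offTime hz i⟩⟩,
    M.strictMono_F, M.bijective_F, fun β γ θ hβ hγ hθ => ?_⟩
  · simpa [realPGF] using M.integral_pow_η z i j
  · have hr : 0 ≤ β * Real.logb 2 (1 + γ) :=
      mul_nonneg hβ (Real.logb_nonneg one_lt_two (by linarith))
    rw [show β * θ * Real.logb 2 (1 + γ) = θ * (β * Real.logb 2 (1 + γ)) by ring]
    exact ⟨M.isEffectiveCapacity hr hθ, M.phi_eq_one_iff hθ⟩
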